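/- All algebras have type $\langle \vee,\wedge,\to,{}',0,1\rangle$, and $x^*:=x\to 0$. A variety is a class of such algebras defined by a set of identities; varieties are ordered by inclusion, $\mathbf V\vee\mathbf W$ is the least variety containing $\mathbf V$ and $\mathbf W$, and $\mathbf V(K)$ is the least variety containing the class $K$. A *semi-Heyting algebra* is a bounded lattice with an operation $\to$ such that $x\wedge(x\to y)\approx x\wedge y$, $x\wedge(y\to z)\approx x\wedge[(x\wedge y)\to(x\wedge z)]$ and $x\to x\approx 1$; it is a Heyting algebra iff moreover (H) $(x\wedge y)\to y\approx 1$. $\mathbf{DQD}$ is the variety of *dually quasi-De Morgan semi-Heyting algebras*: semi-Heyting algebras with a unary operation $'$ such that $0'\approx1$, $1'\approx0$, $(x\wedge y)'\approx x'\vee y'$, $(x\vee y)''\approx x''\vee y''$ and $x''\le x$. Relative to $\mathbf{DQD}$: * $\mathbf{DSt}$ (dually Stone semi-Heyting algebras) is defined by $x'\wedge x''\approx 0$; * $\mathbf{DMB}$ (De Morgan Boolean semi-Heyting algebras) is defined by $x''\approx x$ and $x\vee x^*\approx 1$; * $\mathbf{JID}$ is defined by $x'\vee(y\to z)\approx(x'\vee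 y)\to(x'\vee z)$, and $\mathbf{JID}_1$ is the subvariety of $\mathbf{JID}$ of level $1$, defined by $x\wedge x'^*\approx x\wedge x'^*\wedge x'^*{}'^*$; * $\mathbf{DStH}$ and $\mathbf{JIDH}_1$ are the subvarieties of $\mathbf{DSt}$ and $\mathbf{JID}_1$ defined by (H). Let $\mathbf D_1,\mathbf D_2,\mathbf D_3$ be the algebras on the four-element Boolean lattice $\{0,a,b,1\}$ with $0'=1$, $1'=0$, $a'=a$, $b'=b$ and with $\to$ given by (row $\to$ column) $$\mathbf D_1:\ \begin{array}{c|cccc}\to&0&1&a&b\\\hline 0&1&0&b&a\\1&0&1&a&b\\a&b&a&1&0\\b&a&b&0&1\end{array}\qquad \mathbf D_2:\ \begin{array}{c|cccc}\to&0&1&a&b\\\hline 0&1&1&1&1\\1&0&1&a&b\\a&b&1&1&b\\b&a&1&a&1\end{array}\qquad \mathbf D_3:\ \begin{array}{c|cccc}\to&0&1&a&b\\\hline 0&1&a&1&a\\1&0&1&a&b\\a&b&a&1&0\\b&a&1&a&1\end{array}$$ Then: 1. $\mathbf{JID}_1=\mathbf{DSt}\vee\mathbf V(\mathbf D_1,\mathbf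 D_2,\mathbf D_3)$, and $\mathbf V(\mathbf D_1,\mathbf D_2,\mathbf D_3)=\mathbf{DMB}$. 2. $\mathbf{JIDH}_1=\mathbf{DStH}\vee\mathbf V(\mathbf D_2)$. 3. $\mathcal L(\mathbf{JIDH}_1)\cong\mathbf 1\oplus(\mathcal L^+(\mathbf{DStH})\times\mathbf 2)$, where $\mathcal L(\mathbf V)$ and $\mathcal L^+(\mathbf V)$ are the lattices of all, respectively all nontrivial, subvarieties of $\mathbf V$, $\mathbf 2$ is the two-element chain, and $\mathbf 1\oplus\mathbf L$ is the ordinal sum of the one-element lattice and $\mathbf L$ (a new least element is put below $\mathbf L$). -/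

import Mathlib

universe u

namespace JIDist

/-! ### Algebras of type `⟨∨, ∧, →, ′, 0, 1⟩`, terms and identities -/

/-- An arbitrary algebra of the similarity type `⟨∨, ∧, →, ′, 0, 1⟩`; no law is assumed. -/
structure Alg : Type (u + 1) where
  carrier : Type u
  sup : carrier → carrier → carrier
  inf : carrier → carrier → carrier
  imp : carrier → carrier → carrier
  neg : carrier → carrier
  bot : carrier
  top : carrier

/-- Terms of this type in the variables `var 0, var 1, …`. -/
inductive Term : Type where
  | var : ℕ → Term
  | sup : Term → Term → Term
  | inf : Term → Term → Term
  | imp : Term → Term → Term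
  | neg : Term → Term
  | bot : Term
  | top : Term

/-! In terms, `⊔, ⊓, ⇨, ⊥, ⊤` are the operation symbols `∨, ∧, →, 0, 1`, and `￢` is the unary
operation symbol `′` (only symbols: no law is attached to them). -/

instance : Max Term := ⟨Term.sup⟩
instance : Min Term := ⟨Term.inf⟩
instance : HImp Term := ⟨Term.imp⟩
instance : HNot Term := ⟨Term.neg⟩
instance : Bot Term := ⟨Term.bot⟩
instance : Top Term := ⟨Term.top⟩

/-- The value of a term in `A` under an assignment `v` of the variables. -/
def Term.eval (A : Alg.{u}) (v : ℕ → A.carrier) : Term → A.carrier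
  | .var n => v n
  | .sup s t => A.sup (s.eval A v) (t.eval A v)
  | .inf s t => A.inf (s.eval A v) (t.eval A v)
  | .imp s t => A.imp (s.eval A v) (t.eval A v)
  | .neg s => A.neg (s.eval A v)
  | .bot => A.bot
  | .top => A.top

/-- An identity `lhs ≈ rhs`. -/
structure Identity : Type where
  lhs : Term
  rhs : Term

/-- `s ≐ t` is the identity `s ≈ t`. -/
infix:45 " ≐ " => Identity.mk

/-- `A ⊨ e`: the identity `e` holds in `A` under all assignments. -/
def Alg.Satisfies (A : Alg.{u}) (e : Identity) : Prop :=
  ∀ v : ℕ → A.carrier, e.lhs.eval A v = e.rhs.eval A v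

/-- The class of all algebras satisfying every identity in `E`. -/
def models (E : Set Identity) : Set Alg.{u} := {A | ∀ e ∈ E, A.Satisfies e}

/-! ### Varieties and their lattice -/

/-- A variety: a class of algebras that is defined by some set of identities. -/
@[ext] structure Variety : Type (u + 1) where
  algebras : Set Alg.{u}
  equational : ∃ E : Set Identity, algebras = models E

/-- The variety defined by the set `E` of identities. -/
def Variety.ofIdentities (E : Set Identity) : Variety.{u} := ⟨models E, E, rfl⟩

/-- Varieties are ordered by inclusion. -/
instance : PartialOrder Variety.{u} :=
  PartialOrder.lift Variety.algebras fun _ _ h => Variety.ext h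

/-- The intersection of a family of varieties is a variety. -/
instance : InfSet Variety.{u} where
  sInf S :=
    { algebras := {A | ∀ W ∈ S, A ∈ W.algebras}
      equational := by
        refine ⟨{e | ∃ W ∈ S, ∀ A ∈ W.algebras, A.Satisfies e}, Set.ext fun A => ⟨?_, ?_⟩⟩
        · rintro hA e ⟨W, hW, he⟩
          exact he A (hA W hW)
        · intro hA W hW
          obtain ⟨E, hE⟩ := W.equational
          rw [hE]
          intro e he
          refine hA e ⟨W, hW, fun B hB => ?_⟩
          rw [hE] at hB
          exact hB e he }

/-- The lattice of all varieties. Meets are intersections, the join `V ⊔ W` is the least variety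
containing `V` and `W`, and `⊥` is the least variety, that is, the trivial one. -/
instance : CompleteLattice Variety.{u} :=
  completeLatticeOfInf _ fun _ => ⟨fun _ hW _ hA => hA _ hW, fun _ hV _ hA _ hW => hV hW hA⟩

/-- `V(K)`: the variety generated by the class `K`, the least variety that contains `K`. -/
def generated (K : Set Alg.{u}) : Variety.{u} := sInf {W | K ⊆ W.algebras}

/-- The lattice of subvarieties of `V`. -/
abbrev Subvarieties (V : Variety.{u}) : Type (u + 1) := Set.Iic V

/-- The nontrivial subvarieties of `V`, ordered by inclusion. -/
abbrev NontrivialSubvarieties (V : Variety.{u}) : Type (u + 1) := Set.Ioc ⊥ V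

/-! ### The identities -/

/-- The variables used in the identities below. -/
abbrev x : Term := .var 0
abbrev y : Term := .var 1
abbrev z : Term := .var 2

/-- `s* := s → 0`. -/
def pstar (s : Term) : Term := s ⇨ ⊥

/-- Bounded lattices. -/
def boundedLatticeIdentities : Set Identity :=
  {x ⊔ y ≐ y ⊔ x, x ⊓ y ≐ y ⊓ x,
    x ⊔ (y ⊔ z) ≐ (x ⊔ y) ⊔ z, x ⊓ (y ⊓ z) ≐ (x ⊓ y) ⊓ z,
    x ⊔ (x ⊓ y) ≐ x, x ⊓ (x ⊔ y) ≐ x,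
    x ⊔ ⊥ ≐ x, x ⊓ ⊤ ≐ x}

/-- Semi-Heyting algebras: bounded lattices with (SH1), (SH2), (SH3). -/
def semiHeytingIdentities : Set Identity :=
  boundedLatticeIdentities ∪
    {x ⊓ (x ⇨ y) ≐ x ⊓ y,
      x ⊓ (y ⇨ z) ≐ x ⊓ ((x ⊓ y) ⇨ (x ⊓ z)),
      x ⇨ x ≐ ⊤}

/-- Dually quasi-De Morgan semi-Heyting algebras. The last identity says `x′′ ≤ x`. -/
def dqdIdentities : Set Identity :=
  semiHeytingIdentities ∪
    {￢⊥ ≐ ⊤, ￢⊤ ≐ ⊥,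
      ￢(x ⊓ y) ≐ ￢x ⊔ ￢y,
      ￢￢(x ⊔ y) ≐ ￢￢x ⊔ ￢￢y,
      ￢￢x ⊓ x ≐ ￢￢x}

/-- The iterates of `s ↦ s′*`. -/
def iter : ℕ → Term → Term
  | 0, s => s
  | n + 1, s => pstar (￢(iter n s))

/-- The terms `tₙ(s)` in the definition of level `n`. -/
def levelTerm : ℕ → Term → Term
  | 0, s => s
  | n + 1, s => levelTerm n s ⊓ iter (n + 1) s

/-! ### The varieties -/

/-- Dually quasi-De Morgan semi-Heyting algebras. -/
def DQD : Variety.{u} := .ofIdentities dqdIdentities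

/-- The subvariety of `V` defined by the identity `e`. -/
def Variety.definedBy (V : Variety.{u}) (e : Identity) : Variety.{u} := V ⊓ .ofIdentities {e}

/-- The dual Stone identity `x′ ∧ x′′ ≈ 0`: dually Stone semi-Heyting algebras. -/
def DSt : Variety.{u} := DQD.definedBy (￢x ⊓ ￢￢x ≐ ⊥)

/-- De Morgan semi-Heyting algebras. -/
def DM : Variety.{u} := DQD.definedBy (￢￢x ≐ x)

/-- De Morgan Boolean semi-Heyting algebras. -/
def DMB : Variety.{u} := DM.definedBy (x ⊔ pstar x ≐ ⊤)

/-- JI-distributive dually quasi-De Morgan semi-Heyting algebras. -/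
def JID : Variety.{u} := DQD.definedBy (￢x ⊔ (y ⇨ z) ≐ (￢x ⊔ y) ⇨ (￢x ⊔ z))

/-- The dually quasi-De Morgan semi-Heyting algebras of level `n`. -/
def DQDLevel (n : ℕ) : Variety.{u} := DQD.definedBy (levelTerm n x ≐ levelTerm (n + 1) x)

/-- The members of `JID` of level 1. -/
def JID1 : Variety.{u} := JID ⊓ DQDLevel 1

/-- The identity saying that a semi-Heyting algebra is a Heyting algebra. -/
def heyting : Identity := (x ⊓ y) ⇨ y ≐ ⊤

/-- Dually Stone Heyting algebras. -/
def DStH : Variety.{u} := DSt.definedBy heyting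

/-- The members of `JID1` whose semi-Heyting reduct is a Heyting algebra. -/
def JIDH1 : Variety.{u} := JID1.definedBy heyting

/-! ### The algebras `D₁, D₂, D₃` -/

/-- The four-element set `{0, 1, a, b}`. -/
inductive Four : Type where
  | o | i | a | b
  deriving DecidableEq

namespace Four

/-- Join of the four-element Boolean lattice with bottom `o`, top `i` and atoms `a, b`. -/
def sup : Four → Four → Four
  | o, t => t
  | i, _ => i
  | a, o => a | a, i => i | a, a => a | a, b => i
  | b, o => b | b, i => i | b, a => i | b, b => b

/-- Meet of the four-element Boolean lattice. -/
def inf : Four → Four → Four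
  | o, _ => o
  | i, t => t
  | a, o => o | a, i => a | a, a => a | a, b => o
  | b, o => o | b, i => b | b, a => o | b, b => b

/-- The operation `′`, which fixes both atoms. -/
def neg : Four → Four
  | o => i | i => o | a => a | b => b

/-- The operation `→` of `D₁`. -/
def imp1 : Four → Four → Four
  | o, o => i | o, i => o | o, a => b | o, b => a
  | i, o => o | i, i => i | i, a => a | i, b => b
  | a, o => b | a, i => a | a, a => i | a, b => o
  | b, o => a | b, i => b | b, a => o | b, b => i

/-- The operation `→` of `D₂`. -/
def imp2 : Four → Four → Four
  | o, o => i | o, i => i | o, a => i | o, b => i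
  | i, o => o | i, i => i | i, a => a | i, b => b
  | a, o => b | a, i => i | a, a => i | a, b => b
  | b, o => a | b, i => i | b, a => a | b, b => i

/-- The operation `→` of `D₃`. -/
def imp3 : Four → Four → Four
  | o, o => i | o, i => a | o, a => i | o, b => a
  | i, o => o | i, i => i | i, a => a | i, b => b
  | a, o => b | a, i => a | a, a => i | a, b => o
  | b, o => a | b, i => i | b, a => a | b, b => i

/-- The algebra on the four-element Boolean lattice with `′` as above and the given `→`. -/
def alg (imp : Four → Four → Four) : Alg.{u} where
  carrier := ULift.{u} Four
  sup s t := ⟨sup s.down t.down⟩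
  inf s t := ⟨inf s.down t.down⟩
  imp s t := ⟨imp s.down t.down⟩
  neg s := ⟨neg s.down⟩
  bot := ⟨o⟩
  top := ⟨i⟩

end Four

/-- The algebra `D₁`. -/
def D1 : Alg.{u} := Four.alg Four.imp1

/-- The algebra `D₂`. -/
def D2 : Alg.{u} := Four.alg Four.imp2

/-- The algebra `D₃`. -/
def D3 : Alg.{u} := Four.alg Four.imp3

end JIDist

/-!
# Level 1 JI-distributive algebras: decomposition and subvarieties

In a JI-distributive algebra every `a′` is complemented, so that the closed elements (`a′′ = a`)
form a Boolean algebra on which `′` is a De Morgan negation commuting with complementation. Call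
a central element `e` a Boolean part (`IsBooleanPart`) if `e′` is its complement and every element
below `e` is closed, that is, if the factor below `e` is De Morgan Boolean. At level 1, each failure
`a′ ∧ a′′` of the dual Stone identity lies below a Boolean part (`exists_isBooleanPart`). Boolean
parts are closed under joins, so identifying elements that agree outside some Boolean part is a
congruence, and the quotient (`stoneQuotient`) is dually Stone.

An ultrafilter `P` containing a Boolean part has a partner `Q = {a | a′ ∉ P}`, and
`a ↦ (a ∈ P, a ∈ Q)` maps the algebra into the four-element Boolean lattice, with `′` fixing both
atoms. On a Boolean semi-Heyting algebra `→` is determined by the constant `0 → 1`, so the map is a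
homomorphism into `D₁`, `D₂` or `D₃`, according to the coordinates of `0 → 1`
(`IsUltraPair.exists_isHom`); in the Heyting case `0 → 1 = 1` and only `D₂` occurs. Two elements
identified in the quotient are separated by these maps, so the algebra is a subdirect product of a
dually Stone algebra and of subalgebras of `D₁, D₂, D₃` (`satisfies_of_stoneQuotient`). This gives
the joins, and the case where the top element is a Boolean part gives `V(D₁, D₂, D₃) = DMB`.

For the lattice of subvarieties `W` of `JIDH₁`: if `D₂ ∈ W` then `W` is the join of its dually Stone
part and `V(D₂)`; otherwise `W` is dually Stone, because a failure of the dual Stone identity makes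
`D₂` a homomorphic image (`le_DStH_of_D2_notMem`). Conversely a nontrivial `V ≤ DStH` is recovered
from `V ∨ V(D₂)` (`sup_generated_inf_DStH`), by joining both sides of an identity with a term
that is `0` in dually Stone algebras and `1` in `D₂` as soon as some variable takes a value
outside the subalgebra `{0, 1}`, a subalgebra which lies in `V` already.
-/

namespace JIDist

/-! ### Homomorphisms, and varieties through their identities -/

/-- `f` is a homomorphism of algebras. -/
structure Alg.IsHom (A B : Alg.{u}) (f : A.carrier → B.carrier) : Prop where
  sup : ∀ a b, f (A.sup a b) = B.sup (f a) (f b)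
  inf : ∀ a b, f (A.inf a b) = B.inf (f a) (f b)
  imp : ∀ a b, f (A.imp a b) = B.imp (f a) (f b)
  neg : ∀ a, f (A.neg a) = B.neg (f a)
  bot : f A.bot = B.bot
  top : f A.top = B.top

namespace Alg.IsHom

variable {A B : Alg.{u}} {f : A.carrier → B.carrier}

theorem eval (hf : A.IsHom B f) (v : ℕ → A.carrier) (t : Term) :
    f (t.eval A v) = t.eval B (f ∘ v) := by
  induction t with
  | var n => rfl
  | sup s t hs ht => simp only [Term.eval, hf.sup, hs, ht]
  | inf s t hs ht => simp only [Term.eval, hf.inf, hs, ht]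
  | imp s t hs ht => simp only [Term.eval, hf.imp, hs, ht]
  | neg s hs => simp only [Term.eval, hf.neg, hs]
  | bot => exact hf.bot
  | top => exact hf.top

theorem satisfies_of_surjective (hf : A.IsHom B f) (hs : f.Surjective) {e : Identity}
    (he : A.Satisfies e) : B.Satisfies e := by
  intro v
  obtain ⟨w, hw⟩ : ∃ w : ℕ → A.carrier, f ∘ w = v :=
    ⟨fun n => (hs (v n)).choose, funext fun n => (hs (v n)).choose_spec⟩
  rw [← hw, ← hf.eval, ← hf.eval, he w]

theorem satisfies_of_injective (hf : A.IsHom B f) (hi : f.Injective) {e : Identity}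
    (he : B.Satisfies e) : A.Satisfies e := by
  intro v
  apply hi
  rw [hf.eval, hf.eval, he]

end Alg.IsHom

/-- A variety contains every algebra satisfying all identities that are valid in it. -/
theorem Variety.mem_of_satisfies (V : Variety.{u}) {A : Alg.{u}}
    (h : ∀ e, (∀ B ∈ V.algebras, B.Satisfies e) → A.Satisfies e) : A ∈ V.algebras := by
  obtain ⟨E, hE⟩ := V.equational
  rw [hE]
  intro e he
  refine h e fun B hB => ?_
  rw [hE] at hB
  exact hB e he

theorem Variety.mem_of_forall_satisfies (V : Variety.{u}) {A B : Alg.{u}} (hA : A ∈ V.algebras)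
    (h : ∀ e, A.Satisfies e → B.Satisfies e) : B ∈ V.algebras :=
  V.mem_of_satisfies fun e he => h e (he A hA)

theorem generated_le_iff {K : Set Alg.{u}} {V : Variety.{u}} :
    generated K ≤ V ↔ K ⊆ V.algebras :=
  ⟨fun h _ hA => h fun _ hW => hW hA, fun h => sInf_le h⟩

theorem mem_generated_iff {K : Set Alg.{u}} {A : Alg.{u}} :
    A ∈ (generated K).algebras ↔ ∀ e, (∀ B ∈ K, B.Satisfies e) → A.Satisfies e := by
  constructor
  · intro hA e he
    have h : generated K ≤ .ofIdentities {e} :=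
      generated_le_iff.2 fun B hB _ hi => hi ▸ he B hB
    exact h hA e rfl
  · intro h
    refine (generated K).mem_of_satisfies fun e he => h e fun B hB => he B ?_
    exact generated_le_iff.1 le_rfl hB

theorem mem_inf_iff {V W : Variety.{u}} {A : Alg.{u}} :
    A ∈ (V ⊓ W).algebras ↔ A ∈ V.algebras ∧ A ∈ W.algebras := by
  have h : ∀ U : Variety.{u}, A ∈ U.algebras ↔ generated {A} ≤ U := fun U => by
    rw [generated_le_iff, Set.singleton_subset_iff]
  rw [h, h, h, le_inf_iff]

theorem mem_definedBy_iff {V : Variety.{u}} {e : Identity} {A : Alg.{u}} :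
    A ∈ (V.definedBy e).algebras ↔ A ∈ V.algebras ∧ A.Satisfies e := by
  rw [Variety.definedBy, mem_inf_iff]
  exact and_congr_right fun _ => ⟨fun h => h e rfl, fun h _ hi => hi ▸ h⟩

theorem mem_sup_iff {V W : Variety.{u}} {A : Alg.{u}} :
    A ∈ (V ⊔ W).algebras ↔ ∀ e, (∀ B ∈ V.algebras, B.Satisfies e) →
      (∀ B ∈ W.algebras, B.Satisfies e) → A.Satisfies e := by
  constructor
  · intro hA e hV hW
    have h : V ⊔ W ≤ .ofIdentities {e} :=
      sup_le (fun B hB _ hi => hi ▸ hV B hB) fun B hB _ hi => hi ▸ hW B hB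
    exact h hA e rfl
  · intro h
    exact (V ⊔ W).mem_of_satisfies fun e he => h e
      (fun B hB => he B ((le_sup_left : V ≤ V ⊔ W) hB))
      fun B hB => he B ((le_sup_right : W ≤ V ⊔ W) hB)

/-- The least variety consists of the one-element algebras. -/
theorem mem_bot_iff {A : Alg.{u}} : A ∈ (⊥ : Variety.{u}).algebras ↔ Subsingleton A.carrier := by
  constructor
  · intro hA
    have h : (⊥ : Variety.{u}) ≤ .ofIdentities {x ≐ y} := bot_le
    refine ⟨fun a b => ?_⟩
    exact h hA _ rfl (fun n => if n = 0 then a else b)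
  · intro _
    exact Variety.mem_of_satisfies _ fun e _ v => Subsingleton.elim _ _

/-! ### Dually quasi-De Morgan semi-Heyting algebras as a class -/

/-- A dually quasi-De Morgan semi-Heyting algebra. The operation `′` is written `￢`; the
semi-Heyting implication is `imp`, since `⇨` will denote the Heyting implication of the
underlying lattice. -/
class DQDAlgebra (α : Type u) extends Lattice α, BoundedOrder α, HNot α where
  imp : α → α → α
  inf_imp_self : ∀ a b : α, a ⊓ imp a b = a ⊓ b
  inf_imp : ∀ a b c : α, a ⊓ imp b c = a ⊓ imp (a ⊓ b) (a ⊓ c)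
  imp_self_eq : ∀ a : α, imp a a = ⊤
  neg_bot : ￢(⊥ : α) = ⊤
  neg_top : ￢(⊤ : α) = ⊥
  neg_inf_eq : ∀ a b : α, ￢(a ⊓ b) = ￢a ⊔ ￢b
  neg_neg_sup : ∀ a b : α, ￢￢(a ⊔ b) = ￢￢a ⊔ ￢￢b
  neg_neg_inf_self : ∀ a : α, ￢￢a ⊓ a = ￢￢a

/-- A `DQDAlgebra` as an algebra of the type `⟨∨, ∧, →, ′, 0, 1⟩`. -/
abbrev toAlg (α : Type u) [DQDAlgebra α] : Alg.{u} where
  carrier := α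
  sup := (· ⊔ ·)
  inf := (· ⊓ ·)
  imp := DQDAlgebra.imp
  neg a := ￢a
  bot := ⊥
  top := ⊤

/-- Three values for the variables `x`, `y`, `z`. -/
abbrev assign {α : Type u} (a b c : α) : ℕ → α
  | 0 => a
  | 1 => b
  | _ => c

/-- The `DQDAlgebra` structure on a member `A` of `DQD`. Its operations are those of `A`, so that
`toAlg A.carrier` is definitionally `A`. -/
abbrev dqdAlgebraOfMem {A : Alg.{u}} (h : A ∈ DQD.{u}.algebras) : DQDAlgebra A.carrier :=
  have law : ∀ e ∈ dqdIdentities, A.Satisfies e := h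
  letI : Max A.carrier := ⟨A.sup⟩
  letI : Min A.carrier := ⟨A.inf⟩
  letI L : Lattice A.carrier := Lattice.mk'
    (fun a b => law (x ⊔ y ≐ y ⊔ x)
      (by simp [dqdIdentities, semiHeytingIdentities, boundedLatticeIdentities]) (assign a b b))
    (fun a b c => (law (x ⊔ (y ⊔ z) ≐ (x ⊔ y) ⊔ z)
      (by simp [dqdIdentities, semiHeytingIdentities, boundedLatticeIdentities])
      (assign a b c)).symm)
    (fun a b => law (x ⊓ y ≐ y ⊓ x)
      (by simp [dqdIdentities, semiHeytingIdentities, boundedLatticeIdentities]) (assign a b b))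
    (fun a b c => (law (x ⊓ (y ⊓ z) ≐ (x ⊓ y) ⊓ z)
      (by simp [dqdIdentities, semiHeytingIdentities, boundedLatticeIdentities])
      (assign a b c)).symm)
    (fun a b => law (x ⊔ (x ⊓ y) ≐ x)
      (by simp [dqdIdentities, semiHeytingIdentities, boundedLatticeIdentities]) (assign a b b))
    (fun a b => law (x ⊓ (x ⊔ y) ≐ x)
      (by simp [dqdIdentities, semiHeytingIdentities, boundedLatticeIdentities]) (assign a b b))
  { L with
    top := A.top
    bot := A.bot
    hnot := A.neg
    imp := A.imp
    le_top := fun a => inf_eq_left.1 (law (x ⊓ ⊤ ≐ x)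
      (by simp [dqdIdentities, semiHeytingIdentities, boundedLatticeIdentities]) (assign a a a))
    bot_le := fun a => sup_eq_left.1 (law (x ⊔ ⊥ ≐ x)
      (by simp [dqdIdentities, semiHeytingIdentities, boundedLatticeIdentities]) (assign a a a))
    inf_imp_self := fun a b => law (x ⊓ (x ⇨ y) ≐ x ⊓ y)
      (by simp [dqdIdentities, semiHeytingIdentities]) (assign a b b)
    inf_imp := fun a b c => law (x ⊓ (y ⇨ z) ≐ x ⊓ ((x ⊓ y) ⇨ (x ⊓ z)))
      (by simp [dqdIdentities, semiHeytingIdentities]) (assign a b c)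
    imp_self_eq := fun a => law (x ⇨ x ≐ ⊤)
      (by simp [dqdIdentities, semiHeytingIdentities]) (assign a a a)
    neg_bot := law (￢⊥ ≐ ⊤) (by simp [dqdIdentities]) fun _ => A.bot
    neg_top := law (￢⊤ ≐ ⊥) (by simp [dqdIdentities]) fun _ => A.bot
    neg_inf_eq := fun a b => law (￢(x ⊓ y) ≐ ￢x ⊔ ￢y) (by simp [dqdIdentities]) (assign a b b)
    neg_neg_sup := fun a b => law (￢￢(x ⊔ y) ≐ ￢￢x ⊔ ￢￢y)
      (by simp [dqdIdentities]) (assign a b b)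
    neg_neg_inf_self := fun a => law (￢￢x ⊓ x ≐ ￢￢x) (by simp [dqdIdentities]) (assign a a a) }

theorem toAlg_mem_DQD (α : Type u) [DQDAlgebra α] : toAlg α ∈ DQD.{u}.algebras := by
  intro e he
  simp only [dqdIdentities, semiHeytingIdentities, boundedLatticeIdentities, Set.mem_union,
    Set.mem_insert_iff, Set.mem_singleton_iff] at he
  rcases he with (((rfl | rfl | rfl | rfl | rfl | rfl | rfl | rfl) | (rfl | rfl | rfl)) |
    (rfl | rfl | rfl | rfl | rfl)) <;> intro v
  · exact sup_comm (v 0) (v 1)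
  · exact inf_comm (v 0) (v 1)
  · exact (sup_assoc (v 0) (v 1) (v 2)).symm
  · exact (inf_assoc (v 0) (v 1) (v 2)).symm
  · exact sup_inf_self (a := v 0) (b := v 1)
  · exact inf_sup_self (a := v 0) (b := v 1)
  · exact sup_bot_eq (v 0)
  · exact inf_top_eq (v 0)
  · exact DQDAlgebra.inf_imp_self (v 0) (v 1)
  · exact DQDAlgebra.inf_imp (v 0) (v 1) (v 2)
  · exact DQDAlgebra.imp_self_eq (v 0)
  · exact DQDAlgebra.neg_bot (α := α)
  · exact DQDAlgebra.neg_top (α := α)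
  · exact DQDAlgebra.neg_inf_eq (v 0) (v 1)
  · exact DQDAlgebra.neg_neg_sup (v 0) (v 1)
  · exact DQDAlgebra.neg_neg_inf_self (v 0)

namespace DQDAlgebra

variable {α : Type u} [DQDAlgebra α]

/-- The lattice reduct of a semi-Heyting algebra is a Heyting algebra, with relative
pseudocomplement `a → (a ∧ b)` and pseudocomplement `a* = a → 0`. -/
instance : HeytingAlgebra α where
  himp a b := imp a (a ⊓ b)
  compl a := imp a ⊥
  le_himp_iff a b c := by
    constructor
    · intro h
      calc a ⊓ b ≤ imp b (b ⊓ c) ⊓ b := inf_le_inf_right _ h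
        _ = b ⊓ (b ⊓ c) := by rw [inf_comm, inf_imp_self]
        _ ≤ c := inf_le_right.trans inf_le_right
    · intro h
      have h1 : a ⊓ imp b (b ⊓ c) = a := by
        rw [inf_imp, ← inf_assoc, inf_eq_left.2 h, imp_self_eq, inf_top_eq]
      exact inf_eq_left.1 h1
  himp_bot a := by
    rw [inf_bot_eq]

theorem imp_bot (a : α) : imp a ⊥ = aᶜ := rfl

theorem neg_neg_le (a : α) : ￢￢a ≤ a := inf_eq_left.1 (neg_neg_inf_self a)

theorem neg_anti {a b : α} (h : a ≤ b) : ￢b ≤ ￢a := by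
  rw [← inf_eq_left.2 h, neg_inf_eq]
  exact le_sup_right

theorem neg_neg_neg (a : α) : ￢￢￢a = ￢a :=
  le_antisymm (neg_neg_le _) (neg_anti (neg_neg_le a))

theorem inf_compl_imp_left (c a b : α) (h : a ⊓ c = ⊥) : c ⊓ imp a b = c ⊓ imp ⊥ b := by
  rw [inf_imp c a, inf_imp c ⊥, inf_comm c a, h, inf_bot_eq]

/-- For complemented `c`, joining with `c` distributes over `→`. -/
theorem sup_imp_of_isCompl {c d : α} (h : IsCompl c d) (a b : α) :
    c ⊔ imp a b = imp (c ⊔ a) (c ⊔ b) := by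
  have hc : c ⊓ imp (c ⊔ a) (c ⊔ b) = c := by
    rw [inf_imp, inf_sup_self, inf_sup_self, imp_self_eq, inf_top_eq]
  have hd (e : α) : d ⊓ (c ⊔ e) = d ⊓ e := by
    rw [inf_sup_left, inf_comm, h.inf_eq_bot, bot_sup_eq]
  have hd' : d ⊓ imp (c ⊔ a) (c ⊔ b) = d ⊓ imp a b := by
    rw [inf_imp, hd, hd, ← inf_imp]
  calc c ⊔ imp a b = c ⊔ d ⊓ imp a b := by
        rw [sup_inf_left, h.sup_eq_top, top_inf_eq]
    _ = (c ⊔ d) ⊓ imp (c ⊔ a) (c ⊔ b) := by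
        rw [← hd', inf_sup_right, hc]
    _ = imp (c ⊔ a) (c ⊔ b) := by rw [h.sup_eq_top, top_inf_eq]

/-- Meeting with `f` is compatible with `′` when `f ∧ f′ = 0`. -/
theorem inf_neg_inf {f : α} (hf : f ⊓ ￢f = ⊥) (a : α) : f ⊓ ￢(f ⊓ a) = f ⊓ ￢a := by
  rw [neg_inf_eq, inf_sup_left, hf, bot_sup_eq]

end DQDAlgebra

open DQDAlgebra

/-- The identity of JI-distributivity. -/
class IsJID (α : Type u) [DQDAlgebra α] : Prop where
  sup_imp : ∀ a b c : α, ￢a ⊔ imp b c = imp (￢a ⊔ b) (￢a ⊔ c)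

/-- The identity of level 1, `x ∧ x′* ≤ x′*′*`. -/
class IsLevelOne (α : Type u) [DQDAlgebra α] : Prop where
  level : ∀ a : α, a ⊓ (￢a)ᶜ ≤ (￢(￢a)ᶜ)ᶜ

theorem toAlg_mem_JID1_iff {α : Type u} [DQDAlgebra α] :
    toAlg α ∈ JID1.{u}.algebras ↔ IsJID α ∧ IsLevelOne α := by
  rw [JID1, mem_inf_iff, JID, DQDLevel, mem_definedBy_iff, mem_definedBy_iff]
  simp only [toAlg_mem_DQD, true_and]
  refine and_congr ⟨fun h => ⟨fun a b c => h (assign a b c)⟩,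
    fun h v => h.sup_imp (v 0) (v 1) (v 2)⟩ ⟨fun h => ⟨fun a => ?_⟩, fun h v => ?_⟩
  · exact inf_eq_left.1 (h (assign a a a)).symm
  · exact (inf_eq_left.2 (h.level (v 0))).symm

theorem toAlg_mem_DSt_iff {α : Type u} [DQDAlgebra α] :
    toAlg α ∈ DSt.{u}.algebras ↔ ∀ a : α, ￢a ⊓ ￢￢a = ⊥ := by
  rw [DSt, mem_definedBy_iff]
  simp only [toAlg_mem_DQD, true_and]
  exact ⟨fun h a => h (assign a a a), fun h v => h (v 0)⟩

theorem toAlg_mem_DMB_iff {α : Type u} [DQDAlgebra α] :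
    toAlg α ∈ DMB.{u}.algebras ↔ (∀ a : α, ￢￢a = a) ∧ ∀ a : α, a ⊔ aᶜ = ⊤ := by
  rw [DMB, mem_definedBy_iff, DM, mem_definedBy_iff]
  simp only [toAlg_mem_DQD, true_and]
  exact and_congr ⟨fun h a => h (assign a a a), fun h v => h (v 0)⟩
    ⟨fun h a => h (assign a a a), fun h v => h (v 0)⟩

theorem toAlg_satisfies_heyting_iff {α : Type u} [DQDAlgebra α] :
    (toAlg α).Satisfies heyting ↔ ∀ a b : α, imp (a ⊓ b) b = ⊤ :=
  ⟨fun h a b => h (assign a b b), fun h v => h (v 0) (v 1)⟩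

/-- In a dually Stone algebra `x′′` is the complement of `x′`. -/
theorem isCompl_neg_of_dSt {α : Type u} [DQDAlgebra α] (h : ∀ a : α, ￢a ⊓ ￢￢a = ⊥) (a : α) :
    IsCompl (￢a) (￢￢a) := by
  refine IsCompl.of_eq (h a) ?_
  rw [← neg_bot, ← h a, neg_inf_eq, neg_neg_neg, sup_comm]

theorem JID1_of_dSt {α : Type u} [DQDAlgebra α] (h : ∀ a : α, ￢a ⊓ ￢￢a = ⊥) :
    IsJID α ∧ IsLevelOne α := by
  refine ⟨⟨fun a => sup_imp_of_isCompl (isCompl_neg_of_dSt h a)⟩, ⟨fun a => ?_⟩⟩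
  have hc := (isCompl_neg_of_dSt h a).compl_eq
  rw [hc, neg_neg_neg, hc]
  exact inf_le_right

theorem JID1_of_dMB {α : Type u} [DQDAlgebra α] (h : ∀ a : α, ￢￢a = a)
    (hb : ∀ a : α, a ⊔ aᶜ = ⊤) : IsJID α ∧ IsLevelOne α := by
  have hc (a : α) : IsCompl a aᶜ := IsCompl.of_eq (inf_compl_self _) (hb a)
  refine ⟨⟨fun a => sup_imp_of_isCompl (hc _)⟩, ⟨fun a => ?_⟩⟩
  -- `a = a′′` and `a′*′` are disjoint because `a′ ∨ a′* = 1`.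
  have h1 : ￢(￢a)ᶜ ⊓ a = ⊥ := by
    rw [← h (￢(￢a)ᶜ ⊓ a), neg_inf_eq, h, sup_comm, hb, neg_top]
  exact inf_le_left.trans (le_compl_iff_disjoint_left.2 (disjoint_iff.2 h1))

/-! ### The Boolean algebra of closed elements -/

section JID

variable {α : Type u} [DQDAlgebra α] [IsJID α]

/-- In a JI-distributive algebra every `a′` is complemented. -/
theorem isCompl_neg_compl (a : α) : IsCompl (￢a) (￢a)ᶜ := by
  refine IsCompl.of_eq (inf_compl_self _) ?_
  rw [← imp_bot, IsJID.sup_imp, sup_idem, sup_bot_eq, imp_self_eq]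

theorem neg_neg_compl_neg (a : α) : ￢￢(￢a)ᶜ = (￢a)ᶜ := by
  refine le_antisymm (neg_neg_le _) ?_
  rw [(isCompl_neg_compl a).symm.left_le_iff, codisjoint_iff, sup_comm]
  rw [← neg_neg_neg a, ← neg_neg_sup, neg_neg_neg, (isCompl_neg_compl a).sup_eq_top, neg_top,
    neg_bot]

/-- The closed elements are closed under meets. -/
theorem neg_neg_neg_inf_neg (a b : α) : ￢￢(￢a ⊓ ￢b) = ￢a ⊓ ￢b := by
  have h : ￢a ⊓ ￢b = (￢(￢(￢a)ᶜ ⊓ ￢(￢b)ᶜ))ᶜ := by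
    rw [neg_inf_eq, neg_neg_compl_neg, neg_neg_compl_neg, compl_sup,
      (isCompl_neg_compl a).symm.compl_eq, (isCompl_neg_compl b).symm.compl_eq]
  rw [h, neg_neg_compl_neg]

theorem neg_sup (a b : α) : ￢(a ⊔ b) = ￢a ⊓ ￢b := by
  rw [← neg_neg_neg_inf_neg, neg_inf_eq, ← neg_neg_sup, neg_neg_neg]

/-- On closed elements `′` commutes with complementation. -/
theorem neg_compl_neg (a : α) : ￢(￢a)ᶜ = (￢￢a)ᶜ := by
  refine (IsCompl.compl_eq (IsCompl.of_eq ?_ ?_)).symm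
  · rw [← neg_sup, (isCompl_neg_compl a).sup_eq_top, neg_top]
  · rw [← neg_inf_eq, inf_compl_self, neg_bot]

/-! ### Boolean parts -/

/-- `e` is a Boolean part if it is a central element, `′` acting on it as complementation, and all
elements below it are closed: the corresponding direct factor of the algebra is De Morgan
Boolean. -/
structure IsBooleanPart (e : α) : Prop where
  neg_eq : ￢e = eᶜ
  inf_le : ∀ a, e ⊓ a ≤ ￢￢a

namespace IsBooleanPart

variable {e f : α}

theorem neg_neg {α : Type u} [DQDAlgebra α] {e : α} (he : IsBooleanPart e) : ￢￢e = e :=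
  le_antisymm (neg_neg_le e) ((inf_idem e).ge.trans (he.inf_le e))

theorem isCompl (he : IsBooleanPart e) : IsCompl e eᶜ := by
  have h := isCompl_neg_compl (￢e)
  rwa [he.neg_neg] at h

theorem bot {α : Type u} [DQDAlgebra α] : IsBooleanPart (⊥ : α) where
  neg_eq := by rw [neg_bot, compl_bot]
  inf_le a := by simp

theorem sup (he : IsBooleanPart e) (hf : IsBooleanPart f) : IsBooleanPart (e ⊔ f) where
  neg_eq := by rw [neg_sup, he.neg_eq, hf.neg_eq, compl_sup]
  inf_le a := by
    rw [inf_sup_right]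
    exact sup_le (he.inf_le a) (hf.inf_le a)

/-- Below a Boolean part every element is complemented. -/
theorem le_sup_compl (he : IsBooleanPart e) (a : α) : e ≤ a ⊔ aᶜ := by
  have h1 : e ⊓ (￢￢a)ᶜ ≤ aᶜ := by
    rw [le_compl_iff_disjoint_left, disjoint_iff_inf_le]
    calc a ⊓ (e ⊓ (￢￢a)ᶜ) = (e ⊓ a) ⊓ (￢￢a)ᶜ := by rw [inf_left_comm, inf_assoc]
      _ ≤ ￢￢a ⊓ (￢￢a)ᶜ := inf_le_inf_right _ (he.inf_le a)
      _ = ⊥ := inf_compl_self _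
  calc e = e ⊓ (￢￢a ⊔ (￢￢a)ᶜ) := by rw [(isCompl_neg_compl _).sup_eq_top, inf_top_eq]
    _ = e ⊓ ￢￢a ⊔ e ⊓ (￢￢a)ᶜ := inf_sup_left _ _ _
    _ ≤ a ⊔ aᶜ := sup_le_sup (inf_le_right.trans (neg_neg_le a)) h1

theorem compl_inf_neg_compl {α : Type u} [DQDAlgebra α] {e : α} (he : IsBooleanPart e) :
    eᶜ ⊓ ￢eᶜ = ⊥ := by
  rw [← he.neg_eq, he.neg_neg, he.neg_eq, inf_comm, inf_compl_self]

end IsBooleanPart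

/-- At level 1 the elements below `c′* ∧ c*`, for a closed element `c`, are closed. -/
theorem inf_le_neg_neg [IsLevelOne α] {c : α} (hc : ￢￢c = c) (a : α) :
    (￢c)ᶜ ⊓ cᶜ ⊓ a ≤ ￢￢a := by
  have h1 (b : α) : b ⊓ (￢b)ᶜ ≤ ￢￢b := by
    have h := IsLevelOne.level b
    rwa [neg_compl_neg, (isCompl_neg_compl (￢b)).symm.compl_eq] at h
  have h2 : (￢c)ᶜ ⊓ a ≤ ￢￢a ⊔ c := by
    calc (￢c)ᶜ ⊓ a ≤ (a ⊔ c) ⊓ (￢(a ⊔ c))ᶜ :=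
          le_inf (inf_le_right.trans le_sup_left)
            (inf_le_left.trans (compl_le_compl (neg_anti le_sup_right)))
      _ ≤ ￢￢(a ⊔ c) := h1 _
      _ = ￢￢a ⊔ c := by rw [neg_neg_sup, hc]
  calc (￢c)ᶜ ⊓ cᶜ ⊓ a = ((￢c)ᶜ ⊓ a) ⊓ cᶜ := by rw [inf_right_comm]
    _ ≤ (￢￢a ⊔ c) ⊓ cᶜ := inf_le_inf_right _ h2
    _ ≤ ￢￢a := by
        rw [inf_sup_right, inf_compl_self, sup_bot_eq]
        exact inf_le_left

/-- At level 1 each failure of the dual Stone identity lies below a Boolean part. For `p = a′`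
the Boolean part is the symmetric difference of `p` and the complement of `p′`. -/
theorem exists_isBooleanPart [IsLevelOne α] (a : α) :
    ∃ e : α, IsBooleanPart e ∧ ￢a ⊓ ￢￢a ≤ e := by
  have hp := isCompl_neg_compl a
  have hq := isCompl_neg_compl (￢a)
  refine ⟨￢a ⊓ ￢￢a ⊔ (￢a)ᶜ ⊓ (￢￢a)ᶜ, ⟨?_, fun b => ?_⟩, le_sup_left⟩
  · rw [neg_sup, neg_inf_eq, neg_inf_eq, neg_compl_neg, neg_compl_neg, neg_neg_neg, compl_sup]
    rw [(hp.inf_sup hq).compl_eq, (hp.symm.inf_sup hq.symm).compl_eq, inf_comm,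
      sup_comm (￢a)ᶜ, sup_comm (￢a)]
  · rw [inf_sup_right]
    refine sup_le ?_ ?_
    · have h := inf_le_neg_neg (neg_neg_compl_neg a) b
      rwa [neg_compl_neg, hp.symm.compl_eq, hq.symm.compl_eq, inf_comm (￢￢a)] at h
    · have h := inf_le_neg_neg (neg_neg_neg a) b
      rwa [inf_comm (￢￢a)ᶜ] at h

end JID

/-! ### The dually Stone quotient -/

section Quotient

variable (α : Type u) [DQDAlgebra α] [IsJID α]

/-- Two elements are identified if they agree outside some Boolean part. -/
def stoneSetoid : Setoid α where
  r a b := ∃ e : α, IsBooleanPart e ∧ eᶜ ⊓ a = eᶜ ⊓ b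
  iseqv :=
    { refl := fun _ => ⟨⊥, .bot, rfl⟩
      symm := fun ⟨e, he, h⟩ => ⟨e, he, h.symm⟩
      trans := by
        rintro a b c ⟨e, he, h1⟩ ⟨f, hf, h2⟩
        refine ⟨e ⊔ f, he.sup hf, ?_⟩
        rw [compl_sup, inf_assoc, inf_left_comm, h1, inf_left_comm, h2]
        ac_rfl }

variable {α}

/-- An operation that is compatible with meeting a fixed element is compatible with
`stoneSetoid`. -/
theorem stoneSetoid_map₂ {op : α → α → α}
    (hop : ∀ f a b, f ⊓ op a b = f ⊓ op (f ⊓ a) (f ⊓ b)) :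
    ∀ a a', stoneSetoid α a a' → ∀ b b', stoneSetoid α b b' →
      stoneSetoid α (op a b) (op a' b') := by
  rintro a a' ⟨e, he, h1⟩ b b' ⟨f, hf, h2⟩
  refine ⟨e ⊔ f, he.sup hf, ?_⟩
  have h1' : (e ⊔ f)ᶜ ⊓ a = (e ⊔ f)ᶜ ⊓ a' := by
    rw [compl_sup, inf_right_comm, h1, inf_right_comm]
  have h2' : (e ⊔ f)ᶜ ⊓ b = (e ⊔ f)ᶜ ⊓ b' := by
    rw [compl_sup, inf_assoc, h2, inf_assoc]
  rw [hop _ a, hop _ a', h1', h2']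

theorem stoneSetoid_neg {a b : α} : stoneSetoid α a b → stoneSetoid α (￢a) (￢b) := by
  rintro ⟨e, he, h⟩
  refine ⟨e, he, ?_⟩
  rw [← inf_neg_inf he.compl_inf_neg_compl, h, inf_neg_inf he.compl_inf_neg_compl]

variable (α)

/-- The quotient by `stoneSetoid`; at level 1 it is dually Stone. -/
def stoneQuotient : Alg.{u} where
  carrier := Quotient (stoneSetoid α)
  sup := Quotient.map₂ (· ⊔ ·) (stoneSetoid_map₂ fun f a b => by
    rw [← inf_sup_left, ← inf_assoc, inf_idem])
  inf := Quotient.map₂ (· ⊓ ·) (stoneSetoid_map₂ fun f a b => by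
    rw [← inf_inf_distrib_left, inf_left_idem])
  imp := Quotient.map₂ imp (stoneSetoid_map₂ fun f a b => inf_imp f a b)
  neg := Quotient.map (fun a => ￢a) fun _ _ => stoneSetoid_neg
  bot := Quotient.mk _ ⊥
  top := Quotient.mk _ ⊤

theorem isHom_stoneQuotient_mk :
    (toAlg α).IsHom (stoneQuotient α) (Quotient.mk (stoneSetoid α)) :=
  ⟨fun _ _ => rfl, fun _ _ => rfl, fun _ _ => rfl, fun _ => rfl, rfl, rfl⟩

theorem stoneQuotient_satisfies {e : Identity} (he : (toAlg α).Satisfies e) :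
    (stoneQuotient α).Satisfies e :=
  (isHom_stoneQuotient_mk α).satisfies_of_surjective Quotient.mk_surjective he

theorem stoneQuotient_mem_DSt [IsLevelOne α] : stoneQuotient α ∈ DSt.{u}.algebras := by
  refine mem_definedBy_iff.2 ⟨DQD.mem_of_forall_satisfies (toAlg_mem_DQD α)
    fun _ => stoneQuotient_satisfies α, fun v => ?_⟩
  obtain ⟨a, ha⟩ := Quotient.exists_rep (v 0)
  change (stoneQuotient α).inf ((stoneQuotient α).neg (v 0))
    ((stoneQuotient α).neg ((stoneQuotient α).neg (v 0))) = (stoneQuotient α).bot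
  rw [← ha]
  obtain ⟨e, he, h⟩ := exists_isBooleanPart a
  refine Quotient.sound ⟨e, he, ?_⟩
  rw [inf_bot_eq, ← le_bot_iff]
  exact (inf_le_inf_left _ h).trans (compl_inf_self e).le

end Quotient

/-! ### Ultrafilters and homomorphisms into the four-element algebras -/

section Ultrafilter

variable {α : Type u} [DQDAlgebra α]

/-- An ultrafilter of `α`: a proper filter that contains `a` or `a*`, for each `a`. -/
structure IsUltra (P : Set α) : Prop where
  top_mem : ⊤ ∈ P
  inf_mem_iff : ∀ a b, a ⊓ b ∈ P ↔ a ∈ P ∧ b ∈ P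
  compl_mem_iff : ∀ a, aᶜ ∈ P ↔ a ∉ P

namespace IsUltra

variable {P : Set α}

theorem mem_of_le (hP : IsUltra P) {a b : α} (h : a ≤ b) (ha : a ∈ P) : b ∈ P := by
  rw [← inf_eq_left.2 h, hP.inf_mem_iff] at ha
  exact ha.2

theorem bot_notMem (hP : IsUltra P) : (⊥ : α) ∉ P := by
  rw [← hP.compl_mem_iff, compl_bot]
  exact hP.top_mem

theorem sup_mem_iff (hP : IsUltra P) (a b : α) : a ⊔ b ∈ P ↔ a ∈ P ∨ b ∈ P := by
  rw [← not_iff_not, ← hP.compl_mem_iff, compl_sup, hP.inf_mem_iff, hP.compl_mem_iff,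
    hP.compl_mem_iff, not_or]

theorem mem_iff_of_inf_eq (hP : IsUltra P) {a b c : α} (hc : c ∈ P) (h : c ⊓ a = c ⊓ b) :
    a ∈ P ↔ b ∈ P := by
  have h' := hP.inf_mem_iff c a
  rw [h, hP.inf_mem_iff] at h'
  tauto

/-- On a Boolean semi-Heyting algebra `→` is determined by the constant `0 → 1`. -/
theorem imp_mem_iff (hP : IsUltra P) (a b : α) :
    imp a b ∈ P ↔ (a ∈ P ∧ b ∈ P) ∨ (a ∉ P ∧ (b ∈ P → imp ⊥ ⊤ ∈ P)) := by
  by_cases ha : a ∈ P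
  · rw [hP.mem_iff_of_inf_eq ha (inf_imp_self a b)]
    tauto
  · have h1 : imp a b ∈ P ↔ imp ⊥ b ∈ P :=
      hP.mem_iff_of_inf_eq ((hP.compl_mem_iff a).2 ha)
        (inf_compl_imp_left _ _ _ (inf_compl_self a))
    by_cases hb : b ∈ P
    · have h2 : imp ⊥ b ∈ P ↔ imp ⊥ ⊤ ∈ P := by
        refine hP.mem_iff_of_inf_eq hb ?_
        rw [inf_imp b ⊥ b, inf_imp b ⊥ ⊤, inf_idem, inf_top_eq]
      tauto
    · have h2 : imp ⊥ b ∈ P ↔ (⊤ : α) ∈ P := by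
        refine hP.mem_iff_of_inf_eq ((hP.compl_mem_iff b).2 hb) ?_
        rw [inf_imp bᶜ ⊥ b, compl_inf_self, inf_bot_eq, imp_self_eq]
      have := hP.top_mem
      tauto

end IsUltra

/-- Two ultrafilters exchanged by `P ↦ {a | a′ ∉ P}`. -/
structure IsUltraPair (P Q : Set α) : Prop where
  left : IsUltra P
  right : IsUltra Q
  neg_mem_left : ∀ a, ￢a ∈ P ↔ a ∉ Q
  neg_mem_right : ∀ a, ￢a ∈ Q ↔ a ∉ P

theorem IsUltraPair.symm {P Q : Set α} (h : IsUltraPair P Q) : IsUltraPair Q P :=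
  ⟨h.right, h.left, h.neg_mem_right, h.neg_mem_left⟩

/-- Elements that differ below a Boolean part are separated by an ultrafilter that belongs to a
pair. -/
theorem IsBooleanPart.exists_isUltraPair [IsJID α] {e s t : α} (he : IsBooleanPart e)
    (h : ¬ e ⊓ s ≤ t) : ∃ P Q : Set α, IsUltraPair P Q ∧ s ∈ P ∧ t ∉ P := by
  obtain ⟨J, hJ, hle, hd⟩ := DistribLattice.prime_ideal_of_disjoint_filter_ideal
    (F := Order.PFilter.principal (e ⊓ s)) (I := Order.Ideal.principal t)
    (Set.disjoint_left.2 fun a h1 h2 =>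
      h ((Order.PFilter.mem_principal.1 h1).trans (Order.Ideal.mem_principal.1 h2)))
  have hes : e ⊓ s ∉ J := fun h' =>
    Set.disjoint_left.1 hd (Order.PFilter.mem_principal.2 le_rfl) h'
  have heJ : e ∉ J := fun h' => hes (J.lower inf_le_left h')
  have hinf (a b : α) : a ⊓ b ∈ J ↔ a ∈ J ∨ b ∈ J :=
    ⟨hJ.mem_or_mem, fun h' => h'.elim (J.lower inf_le_left) (J.lower inf_le_right)⟩
  have htop : (⊤ : α) ∉ J := fun h' => heJ (J.lower le_top h')
  have hP : IsUltra {a : α | a ∉ J} := by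
    refine ⟨htop, fun a b => ?_, fun a => ?_⟩
    · simp [hinf]
    · simp only [Set.mem_ofPred_eq, not_not]
      refine ⟨fun h' => ?_, fun h1 h2 => heJ (J.lower (he.le_sup_compl a) ?_)⟩
      · have : a ⊓ aᶜ ∈ J := by
          rw [inf_compl_self]
          exact J.bot_mem
        exact ((hinf _ _).1 this).resolve_right h'
      · exact Order.Ideal.sup_mem h1 h2
  -- The pair consists of the complement `P` of `J` and of `{a | a′ ∉ P}`.
  generalize hPJ : {a : α | a ∉ J} = P at hP
  have heP : e ∈ P := hPJ ▸ heJ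
  refine ⟨P, {a | ￢a ∉ P}, ⟨hP, ⟨?_, fun a b => ?_, fun a => ?_⟩, ?_, ?_⟩,
    ?_, ?_⟩
  · simpa only [Set.mem_ofPred_eq, neg_top] using hP.bot_notMem
  · simp only [Set.mem_ofPred_eq, neg_inf_eq, hP.sup_mem_iff, not_or]
  · simp only [Set.mem_ofPred_eq, not_not]
    constructor
    · intro h1
      have h2 : ￢a ⊔ ￢aᶜ ∈ P := by
        rw [← neg_inf_eq, inf_compl_self, neg_bot]
        exact hP.top_mem
      exact ((hP.sup_mem_iff _ _).1 h2).resolve_right h1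
    · intro h1 h2
      have h3 : ￢e ∈ P := by
        refine hP.mem_of_le (neg_anti (he.le_sup_compl a)) ?_
        rw [neg_sup, hP.inf_mem_iff]
        exact ⟨h1, h2⟩
      rw [he.neg_eq, hP.compl_mem_iff] at h3
      exact h3 heP
  · simp
  · intro a
    simp only [Set.mem_ofPred_eq, not_iff_not]
    refine ⟨fun h' => hP.mem_of_le (neg_neg_le a) h', fun h' => hP.mem_of_le (he.inf_le a) ?_⟩
    exact (hP.inf_mem_iff _ _).2 ⟨heP, h'⟩
  · rw [← hPJ]
    exact fun h' => hes (J.lower inf_le_right h')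
  · rw [← hPJ]
    exact fun h' => h' (hle (Order.Ideal.mem_principal.2 le_rfl))

open Classical in
/-- The element of the four-element Boolean lattice with coordinates `p` and `q`; the atom `a`
is `(1, 0)`. -/
noncomputable def Four.ofProps (p q : Prop) : Four :=
  if p then if q then .i else .a else if q then .b else .o

/-- The map into the four-element Boolean lattice given by two sets. -/
noncomputable def fourMap (P Q : Set α) (a : α) : ULift.{u} Four :=
  ⟨Four.ofProps (a ∈ P) (a ∈ Q)⟩

/-- A pair of ultrafilters gives a homomorphism onto a subalgebra of a four-element algebra. The
hypothesis says that the table `f` is the semi-Heyting implication of the four-element Boolean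
lattice for which `0 → 1` has the coordinates `0 → 1 ∈ P` and `0 → 1 ∈ Q`. -/
theorem IsUltraPair.isHom {P Q : Set α} (h : IsUltraPair P Q) {f : Four → Four → Four}
    (hf : ∀ p q r s : Prop, Four.ofProps
        ((p ∧ q) ∨ (¬ p ∧ (q → imp ⊥ ⊤ ∈ P))) ((r ∧ s) ∨ (¬ r ∧ (s → imp ⊥ ⊤ ∈ Q))) =
      f (Four.ofProps p r) (Four.ofProps q s)) :
    (toAlg α).IsHom (Four.alg f) (fourMap P Q) where
  sup a b := by
    refine ULift.ext _ _ ?_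
    change Four.ofProps (a ⊔ b ∈ P) (a ⊔ b ∈ Q) =
      Four.sup (Four.ofProps (a ∈ P) (a ∈ Q)) (Four.ofProps (b ∈ P) (b ∈ Q))
    rw [h.left.sup_mem_iff, h.right.sup_mem_iff]
    by_cases h1 : a ∈ P <;> by_cases h2 : a ∈ Q <;> by_cases h3 : b ∈ P <;>
      by_cases h4 : b ∈ Q <;> simp [Four.ofProps, h1, h2, h3, h4, Four.sup]
  inf a b := by
    refine ULift.ext _ _ ?_
    change Four.ofProps (a ⊓ b ∈ P) (a ⊓ b ∈ Q) =
      Four.inf (Four.ofProps (a ∈ P) (a ∈ Q)) (Four.ofProps (b ∈ P) (b ∈ Q))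
    rw [h.left.inf_mem_iff, h.right.inf_mem_iff]
    by_cases h1 : a ∈ P <;> by_cases h2 : a ∈ Q <;> by_cases h3 : b ∈ P <;>
      by_cases h4 : b ∈ Q <;> simp [Four.ofProps, h1, h2, h3, h4, Four.inf]
  imp a b := by
    refine ULift.ext _ _ ?_
    change Four.ofProps (imp a b ∈ P) (imp a b ∈ Q) =
      f (Four.ofProps (a ∈ P) (a ∈ Q)) (Four.ofProps (b ∈ P) (b ∈ Q))
    rw [h.left.imp_mem_iff, h.right.imp_mem_iff, hf]
  neg a := by
    refine ULift.ext _ _ ?_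
    change Four.ofProps (￢a ∈ P) (￢a ∈ Q) = Four.neg (Four.ofProps (a ∈ P) (a ∈ Q))
    rw [h.neg_mem_left, h.neg_mem_right]
    by_cases h1 : a ∈ P <;> by_cases h2 : a ∈ Q <;> simp [Four.ofProps, h1, h2, Four.neg]
  bot := ULift.ext _ _ (by
    simp [fourMap, Four.ofProps, h.left.bot_notMem, h.right.bot_notMem, Four.alg])
  top := ULift.ext _ _ (by
    simp [fourMap, Four.ofProps, h.left.top_mem, h.right.top_mem, Four.alg])

theorem IsUltraPair.isHom_D2 {P Q : Set α} (h : IsUltraPair P Q) (hk : imp ⊥ ⊤ = (⊤ : α)) :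
    (toAlg α).IsHom D2 (fourMap P Q) := by
  refine h.isHom fun p q r s => ?_
  rw [hk]
  have h1 := h.left.top_mem
  have h2 := h.right.top_mem
  by_cases hp : p <;> by_cases hq : q <;> by_cases hr : r <;> by_cases hs : s <;>
    simp [Four.ofProps, hp, hq, hr, hs, h1, h2, Four.imp2]

/-- Each pair of ultrafilters gives a homomorphism into `D₁`, `D₂` or `D₃`, chosen by the
coordinates of `0 → 1`. -/
theorem IsUltraPair.exists_isHom {P Q : Set α} (h : IsUltraPair P Q) :
    ∃ D ∈ ({D1, D2, D3} : Set Alg.{u}), ∃ f : α → D.carrier, (toAlg α).IsHom D f ∧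
      ∀ a b, f a = f b → (a ∈ P ↔ b ∈ P) := by
  have hinj (P Q : Set α) (a b : α) (hab : fourMap P Q a = fourMap P Q b) :
      (a ∈ P ↔ b ∈ P) ∧ (a ∈ Q ↔ b ∈ Q) := by
    have hab' : Four.ofProps _ _ = Four.ofProps _ _ := congrArg ULift.down hab
    by_cases h1 : a ∈ P <;> by_cases h2 : a ∈ Q <;> by_cases h3 : b ∈ P <;>
      by_cases h4 : b ∈ Q <;> simp_all [Four.ofProps]
  by_cases h1 : imp ⊥ (⊤ : α) ∈ P <;> by_cases h2 : imp ⊥ (⊤ : α) ∈ Q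
  · refine ⟨D2, by simp, fourMap P Q, h.isHom fun p q r s => ?_,
      fun a b hab => (hinj _ _ _ _ hab).1⟩
    by_cases hp : p <;> by_cases hq : q <;> by_cases hr : r <;> by_cases hs : s <;>
      simp [Four.ofProps, hp, hq, hr, hs, h1, h2, Four.imp2]
  · refine ⟨D3, by simp, fourMap P Q, h.isHom fun p q r s => ?_,
      fun a b hab => (hinj _ _ _ _ hab).1⟩
    by_cases hp : p <;> by_cases hq : q <;> by_cases hr : r <;> by_cases hs : s <;>
      simp [Four.ofProps, hp, hq, hr, hs, h1, h2, Four.imp3]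
  · -- In `D₃` the element `0 → 1` is `a = (1, 0)`, so the two ultrafilters are exchanged.
    refine ⟨D3, by simp, fourMap Q P, h.symm.isHom fun p q r s => ?_,
      fun a b hab => (hinj _ _ _ _ hab).2⟩
    by_cases hp : p <;> by_cases hq : q <;> by_cases hr : r <;> by_cases hs : s <;>
      simp [Four.ofProps, hp, hq, hr, hs, h1, h2, Four.imp3]
  · refine ⟨D1, by simp, fourMap P Q, h.isHom fun p q r s => ?_,
      fun a b hab => (hinj _ _ _ _ hab).1⟩
    by_cases hp : p <;> by_cases hq : q <;> by_cases hr : r <;> by_cases hs : s <;>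
      simp [Four.ofProps, hp, hq, hr, hs, h1, h2, Four.imp1]

end Ultrafilter

/-! ### Subdirect decomposition at level 1 -/

section Decomposition

variable {α : Type u} [DQDAlgebra α] [IsJID α]

/-- An identity that holds in those of `D₁, D₂, D₃` into which `α` maps holds below each Boolean
part. -/
theorem IsBooleanPart.inf_eval_eq {e : α} (he : IsBooleanPart e) {i : Identity}
    (hi : ∀ D ∈ ({D1, D2, D3} : Set Alg.{u}), (∃ f, (toAlg α).IsHom D f) → D.Satisfies i)
    (v : ℕ → α) : e ⊓ i.lhs.eval (toAlg α) v = e ⊓ i.rhs.eval (toAlg α) v := by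
  have key {s t : α} (h : ¬ e ⊓ s ≤ t)
      (hst : ∀ D ∈ ({D1, D2, D3} : Set Alg.{u}), ∀ f, (toAlg α).IsHom D f → f s = f t) :
      False := by
    obtain ⟨P, Q, hPQ, hs, ht⟩ := he.exists_isUltraPair h
    obtain ⟨D, hD, f, hf, hP⟩ := hPQ.exists_isHom
    exact ht ((hP s t (hst D hD f hf)).1 hs)
  have hev (D) (hD : D ∈ ({D1, D2, D3} : Set Alg.{u})) (f) (hf : (toAlg α).IsHom D f) :
      f (i.lhs.eval (toAlg α) v) = f (i.rhs.eval (toAlg α) v) := by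
    rw [hf.eval, hf.eval, hi D hD ⟨f, hf⟩]
  refine le_antisymm (le_inf inf_le_left ?_) (le_inf inf_le_left ?_)
  · by_contra h
    exact key h hev
  · by_contra h
    exact key h fun D hD f hf => (hev D hD f hf).symm

/-- The algebra is a subdirect product of its `stoneQuotient` and of subalgebras of
`D₁, D₂, D₃`: two elements with the same image in the quotient agree outside some Boolean part
`e`, and below `e` they are separated by homomorphisms into `D₁, D₂, D₃`. -/
theorem satisfies_of_stoneQuotient {i : Identity} (h : (stoneQuotient α).Satisfies i)
    (hi : ∀ D ∈ ({D1, D2, D3} : Set Alg.{u}), (∃ f, (toAlg α).IsHom D f) → D.Satisfies i) :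
    (toAlg α).Satisfies i := by
  intro v
  have h1 := h (Quotient.mk (stoneSetoid α) ∘ v)
  rw [← (isHom_stoneQuotient_mk α).eval, ← (isHom_stoneQuotient_mk α).eval] at h1
  obtain ⟨e, he, h2⟩ := Quotient.exact h1
  have h3 := he.inf_eval_eq hi v
  have h4 (a : α) : a = e ⊓ a ⊔ eᶜ ⊓ a := by
    rw [← inf_sup_right, he.isCompl.sup_eq_top, top_inf_eq]
  rw [h4 (i.lhs.eval (toAlg α) v), h2, h3]
  exact (h4 _).symm

/-- `D₂` is the only one of the three algebras with `0 → 1 = 1`. -/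
theorem eq_D2_of_isHom {α : Type u} [DQDAlgebra α] (hH : (toAlg α).Satisfies heyting) {D : Alg.{u}}
    (hD : D ∈ ({D1, D2, D3} : Set Alg.{u})) (h : ∃ f, (toAlg α).IsHom D f) : D = D2 := by
  obtain ⟨f, hf⟩ := h
  have h1 : D.imp D.bot D.top = D.top := by
    have h2 := toAlg_satisfies_heyting_iff.1 hH ⊥ ⊤
    rw [inf_top_eq] at h2
    rw [← hf.bot, ← hf.top, ← hf.imp]
    exact congrArg f h2
  rcases hD with rfl | rfl | rfl
  · exact absurd (congrArg ULift.down h1) (by decide +revert)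
  · rfl
  · exact absurd (congrArg ULift.down h1) (by decide +revert)

end Decomposition

/-! ### The varieties generated by `D₁, D₂, D₃` and by `D₂` -/

/-- To prove a property of all members of `DQD`, prove it for the algebras `toAlg α`. -/
theorem DQD_induction {p : Alg.{u} → Prop} (h : ∀ (α : Type u) [DQDAlgebra α], p (toAlg α))
    {A : Alg.{u}} (hA : A ∈ DQD.{u}.algebras) : p A :=
  @h A.carrier (dqdAlgebraOfMem hA)

theorem Four.alg_mem_DMB {f : Four → Four → Four} (h1 : ∀ p q, inf p (f p q) = inf p q)
    (h2 : ∀ p q r, inf p (f q r) = inf p (f (inf p q) (inf p r))) (h3 : ∀ p, f p p = i)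
    (h4 : ∀ p, sup p (f p o) = i) : Four.alg f ∈ DMB.{u}.algebras := by
  refine mem_definedBy_iff.2 ⟨mem_definedBy_iff.2 ⟨?_, fun v => ?_⟩,
    fun v => ULift.ext _ _ (h4 (v 0).down)⟩
  · intro e he
    simp only [dqdIdentities, semiHeytingIdentities, boundedLatticeIdentities, Set.mem_union,
      Set.mem_insert_iff, Set.mem_singleton_iff] at he
    rcases he with (((rfl | rfl | rfl | rfl | rfl | rfl | rfl | rfl) | (rfl | rfl | rfl)) |
      (rfl | rfl | rfl | rfl | rfl)) <;> intro v <;> refine ULift.ext _ _ ?_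
    · have h : ∀ p q, sup p q = sup q p := by rintro (_ | _) (_ | _) <;> rfl
      exact h (v 0).down (v 1).down
    · have h : ∀ p q, inf p q = inf q p := by rintro (_ | _) (_ | _) <;> rfl
      exact h (v 0).down (v 1).down
    · have h : ∀ p q r, sup p (sup q r) = sup (sup p q) r := by
        rintro (_ | _) (_ | _) (_ | _) <;> rfl
      exact h (v 0).down (v 1).down (v 2).down
    · have h : ∀ p q r, inf p (inf q r) = inf (inf p q) r := by
        rintro (_ | _) (_ | _) (_ | _) <;> rfl
      exact h (v 0).down (v 1).down (v 2).down
    · have h : ∀ p q, sup p (inf p q) = p := by rintro (_ | _) (_ | _) <;> rfl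
      exact h (v 0).down (v 1).down
    · have h : ∀ p q, inf p (sup p q) = p := by rintro (_ | _) (_ | _) <;> rfl
      exact h (v 0).down (v 1).down
    · have h : ∀ p, sup p o = p := by rintro (_ | _) <;> rfl
      exact h (v 0).down
    · have h : ∀ p, inf p i = p := by rintro (_ | _) <;> rfl
      exact h (v 0).down
    · exact h1 (v 0).down (v 1).down
    · exact h2 (v 0).down (v 1).down (v 2).down
    · exact h3 (v 0).down
    · rfl
    · rfl
    · have h : ∀ p q, neg (inf p q) = sup (neg p) (neg q) := by
        rintro (_ | _) (_ | _) <;> rfl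
      exact h (v 0).down (v 1).down
    · have h : ∀ p q, neg (neg (sup p q)) = sup (neg (neg p)) (neg (neg q)) := by
        rintro (_ | _) (_ | _) <;> rfl
      exact h (v 0).down (v 1).down
    · have h : ∀ p, inf (neg (neg p)) p = neg (neg p) := by rintro (_ | _) <;> rfl
      exact h (v 0).down
  · have h : ∀ p, neg (neg p) = p := by rintro (_ | _) <;> rfl
    exact ULift.ext _ _ (h (v 0).down)

theorem D1_mem_DMB : D1 ∈ DMB.{u}.algebras :=
  Four.alg_mem_DMB (by rintro (_ | _) (_ | _) <;> rfl) (by rintro (_ | _) (_ | _) (_ | _) <;> rfl)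
    (by rintro (_ | _) <;> rfl) (by rintro (_ | _) <;> rfl)

theorem D2_mem_DMB : D2 ∈ DMB.{u}.algebras :=
  Four.alg_mem_DMB (by rintro (_ | _) (_ | _) <;> rfl) (by rintro (_ | _) (_ | _) (_ | _) <;> rfl)
    (by rintro (_ | _) <;> rfl) (by rintro (_ | _) <;> rfl)

theorem D3_mem_DMB : D3 ∈ DMB.{u}.algebras :=
  Four.alg_mem_DMB (by rintro (_ | _) (_ | _) <;> rfl) (by rintro (_ | _) (_ | _) (_ | _) <;> rfl)
    (by rintro (_ | _) <;> rfl) (by rintro (_ | _) <;> rfl)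

theorem D2_satisfies_heyting : D2.{u}.Satisfies heyting := fun v => by
  have h : ∀ p q, Four.imp2 (Four.inf p q) q = Four.i := by rintro (_ | _) (_ | _) <;> rfl
  exact ULift.ext _ _ (h (v 0).down (v 1).down)

theorem D2_notMem_DSt : D2 ∉ DSt.{u}.algebras := fun h => by
  have h1 := (mem_definedBy_iff.1 h).2 fun _ => ⟨Four.a⟩
  exact absurd (congrArg ULift.down h1) (by decide +revert)

theorem DSt_le_DQD : DSt.{u} ≤ DQD := inf_le_left

theorem DMB_le_DQD : DMB.{u} ≤ DQD := inf_le_left.trans inf_le_left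

theorem JID1_le_DQD : JID1.{u} ≤ DQD := inf_le_left.trans inf_le_left

theorem DSt_le_JID1 : DSt.{u} ≤ JID1 := fun _ hA =>
  DQD_induction (p := fun A => A ∈ DSt.algebras → A ∈ JID1.algebras)
    (fun _ _ h => toAlg_mem_JID1_iff.2 (JID1_of_dSt (toAlg_mem_DSt_iff.1 h))) (DSt_le_DQD hA) hA

theorem DMB_le_JID1 : DMB.{u} ≤ JID1 := fun _ hA =>
  DQD_induction (p := fun A => A ∈ DMB.algebras → A ∈ JID1.algebras)
    (fun _ _ h => toAlg_mem_JID1_iff.2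
      (JID1_of_dMB (toAlg_mem_DMB_iff.1 h).1 (toAlg_mem_DMB_iff.1 h).2)) (DMB_le_DQD hA) hA

theorem generated_D1_D2_D3 : generated.{u} {D1, D2, D3} = DMB := by
  refine le_antisymm (generated_le_iff.2 ?_) fun A hA => ?_
  · rintro _ (rfl | rfl | rfl)
    exacts [D1_mem_DMB, D2_mem_DMB, D3_mem_DMB]
  · refine DQD_induction (p := fun A => A ∈ DMB.algebras → A ∈ (generated _).algebras)
      (fun α _ h => ?_) (DMB_le_DQD hA) hA
    have hm := toAlg_mem_DMB_iff.1 h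
    have := (JID1_of_dMB hm.1 hm.2).1
    have ht : IsBooleanPart (⊤ : α) :=
      ⟨by rw [neg_top, compl_top], fun a => by rw [top_inf_eq, hm.1]⟩
    refine mem_generated_iff.2 fun e he v => ?_
    have h1 := ht.inf_eval_eq (fun D hD _ => he D hD) v
    rwa [top_inf_eq, top_inf_eq] at h1

theorem JID1_eq_sup : JID1.{u} = DSt ⊔ generated {D1, D2, D3} := by
  refine le_antisymm (fun A hA => ?_)
    (sup_le DSt_le_JID1 (generated_D1_D2_D3.le.trans DMB_le_JID1))
  refine DQD_induction
    (p := fun A => A ∈ JID1.algebras → A ∈ (DSt ⊔ generated {D1, D2, D3}).algebras)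
    (fun α _ h => ?_) (JID1_le_DQD hA) hA
  obtain ⟨_, _⟩ := toAlg_mem_JID1_iff.1 h
  refine mem_sup_iff.2 fun e h1 h2 => satisfies_of_stoneQuotient
    (h1 _ (stoneQuotient_mem_DSt α)) fun D hD _ => h2 D (generated_le_iff.1 le_rfl hD)

/-- A subvariety of `JIDH₁` that contains `D₂` is determined by its dually Stone members. -/
theorem eq_sup_of_D2_mem {W : Variety.{u}} (hW : W ≤ JIDH1) (hD : D2 ∈ W.algebras) :
    W = W ⊓ DStH ⊔ generated {D2} := by
  refine le_antisymm (fun A hA => ?_)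
    (sup_le inf_le_left (generated_le_iff.2 (Set.singleton_subset_iff.2 hD)))
  refine DQD_induction (p := fun A => A ∈ W.algebras → A ∈ (W ⊓ DStH ⊔ generated {D2}).algebras)
    (fun α _ h => ?_) (JID1_le_DQD (mem_definedBy_iff.1 (hW hA)).1) hA
  obtain ⟨hJ, hH⟩ := mem_definedBy_iff.1 (hW h)
  obtain ⟨_, _⟩ := toAlg_mem_JID1_iff.1 hJ
  refine mem_sup_iff.2 fun e h1 h2 => satisfies_of_stoneQuotient
    (h1 _ (mem_inf_iff.2 ⟨W.mem_of_forall_satisfies h fun _ => stoneQuotient_satisfies α,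
      mem_definedBy_iff.2 ⟨stoneQuotient_mem_DSt α, stoneQuotient_satisfies α hH⟩⟩))
    fun D hD hf => ?_
  rw [eq_D2_of_isHom hH hD hf]
  exact h2 D2 (generated_le_iff.1 le_rfl rfl)

theorem DStH_le_JIDH1 : DStH.{u} ≤ JIDH1 := inf_le_inf_right _ DSt_le_JID1

theorem D2_mem_JIDH1 : D2 ∈ JIDH1.{u}.algebras :=
  mem_definedBy_iff.2 ⟨DMB_le_JID1 D2_mem_DMB, D2_satisfies_heyting⟩

theorem JIDH1_eq_sup : JIDH1.{u} = DStH ⊔ generated {D2} := by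
  have h := eq_sup_of_D2_mem le_rfl D2_mem_JIDH1.{u}
  rwa [inf_eq_right.2 DStH_le_JIDH1] at h

/-! ### The lattice of subvarieties of `JIDH₁` -/

/-- If a member of `W ≤ JIDH₁` violates the dual Stone identity, then `D₂` is a homomorphic
image of it. -/
theorem le_DStH_of_D2_notMem {W : Variety.{u}} (hW : W ≤ JIDH1) (hD : D2 ∉ W.algebras) :
    W ≤ DStH := fun A hA => by
  refine DQD_induction (p := fun A => A ∈ W.algebras → A ∈ DStH.algebras)
    (fun α _ h => ?_) (JID1_le_DQD (mem_definedBy_iff.1 (hW hA)).1) hA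
  obtain ⟨hJ, hH⟩ := mem_definedBy_iff.1 (hW h)
  obtain ⟨_, _⟩ := toAlg_mem_JID1_iff.1 hJ
  refine mem_definedBy_iff.2 ⟨toAlg_mem_DSt_iff.2 fun a => ?_, hH⟩
  by_contra ha
  obtain ⟨e, he, hle⟩ := exists_isBooleanPart a
  obtain ⟨P, Q, hPQ, hP, -⟩ := he.exists_isUltraPair (s := ￢a ⊓ ￢￢a) (t := ⊥)
    (by rwa [inf_eq_right.2 hle, le_bot_iff])
  rw [hPQ.left.inf_mem_iff, hPQ.neg_mem_left (￢a)] at hP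
  have hk := toAlg_satisfies_heyting_iff.1 hH ⊥ ⊤
  rw [inf_top_eq] at hk
  refine hD (W.mem_of_forall_satisfies h fun i hi =>
    (hPQ.isHom_D2 hk).satisfies_of_surjective ?_ hi)
  rintro ⟨_ | _⟩
  · exact ⟨⊥, (hPQ.isHom_D2 hk).bot⟩
  · exact ⟨⊤, (hPQ.isHom_D2 hk).top⟩
  · exact ⟨￢a, ULift.ext _ _ (by simp [fourMap, Four.ofProps, hP])⟩
  · refine ⟨(￢a)ᶜ, ULift.ext _ _ ?_⟩
    simp [fourMap, Four.ofProps, hP, hPQ.left.compl_mem_iff, hPQ.right.compl_mem_iff]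

/-- The two-element Boolean algebra, `′` being complementation. -/
def two : Alg.{u} where
  carrier := ULift Bool
  sup a b := ⟨a.down || b.down⟩
  inf a b := ⟨a.down && b.down⟩
  imp a b := ⟨!a.down || b.down⟩
  neg a := ⟨!a.down⟩
  bot := ⟨false⟩
  top := ⟨true⟩

theorem two_notMem_bot : two ∉ (⊥ : Variety.{u}).algebras := fun h => by
  have := mem_bot_iff.1 h
  have h1 : (⟨false⟩ : ULift.{u} Bool) = ⟨true⟩ := Subsingleton.elim (α := two.carrier) _ _
  simp at h1

/-- The embedding of `two` as the subalgebra `{0, 1}`. -/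
def ofTwo (A : Alg.{u}) (b : two.{u}.carrier) : A.carrier := bif b.down then A.top else A.bot

theorem ofTwo_injective {A : Alg.{u}} (h : A.bot ≠ A.top) : (ofTwo A).Injective := by
  rintro ⟨_ | _⟩ ⟨_ | _⟩ hab
  exacts [rfl, absurd hab h, absurd hab h.symm, rfl]

theorem ofTwo_D2_injective : (ofTwo D2.{u}).Injective :=
  ofTwo_injective fun h => absurd (congrArg ULift.down h) (by decide +revert)

theorem isHom_ofTwo_D2 : two.{u}.IsHom D2 (ofTwo D2) where
  sup := by rintro ⟨_ | _⟩ ⟨_ | _⟩ <;> rfl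
  inf := by rintro ⟨_ | _⟩ ⟨_ | _⟩ <;> rfl
  imp := by rintro ⟨_ | _⟩ ⟨_ | _⟩ <;> rfl
  neg := by rintro ⟨_ | _⟩ <;> rfl
  bot := rfl
  top := rfl

theorem isHom_ofTwo_toAlg {α : Type u} [DQDAlgebra α] (hH : (toAlg α).Satisfies heyting) :
    two.{u}.IsHom (toAlg α) (ofTwo (toAlg α)) where
  sup := by rintro ⟨_ | _⟩ ⟨_ | _⟩ <;> simp [ofTwo, two]
  inf := by rintro ⟨_ | _⟩ ⟨_ | _⟩ <;> simp [ofTwo, two]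
  imp := by
    have h1 := toAlg_satisfies_heyting_iff.1 hH ⊥ ⊤
    rw [inf_top_eq] at h1
    rintro ⟨_ | _⟩ ⟨_ | _⟩ <;> simp [ofTwo, two, imp_self_eq, h1, imp_bot]
  neg := by rintro ⟨_ | _⟩ <;> simp [ofTwo, two, neg_bot, neg_top]
  bot := rfl
  top := rfl

theorem two_mem_of_ne_bot {V : Variety.{u}} (hV : V ≤ DStH) (hne : V ≠ ⊥) :
    two ∈ V.algebras := by
  obtain ⟨A, hA, hs⟩ : ∃ A ∈ V.algebras, ¬ Subsingleton A.carrier := by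
    by_contra! h
    exact hne (le_bot_iff.1 fun A hA => mem_bot_iff.2 (h A hA))
  refine DQD_induction (p := fun A => A ∈ V.algebras → ¬ Subsingleton A.carrier → two ∈ V.algebras)
    (fun α _ h hs => ?_) (DSt_le_DQD (mem_definedBy_iff.1 (hV hA)).1) hA hs
  have : Nontrivial α := not_subsingleton_iff_nontrivial.1 hs
  have hH := (mem_definedBy_iff.1 (hV h)).2
  refine V.mem_of_forall_satisfies h fun e =>
    (isHom_ofTwo_toAlg hH).satisfies_of_injective (ofTwo_injective bot_ne_top)

theorem two_mem_DStH : two ∈ DStH.{u}.algebras := by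
  have h : two ∈ JIDH1.{u}.algebras :=
    JIDH1.mem_of_forall_satisfies D2_mem_JIDH1 fun e =>
      isHom_ofTwo_D2.satisfies_of_injective ofTwo_D2_injective
  obtain ⟨hJ, hH⟩ := mem_definedBy_iff.1 h
  refine mem_definedBy_iff.2 ⟨mem_definedBy_iff.2 ⟨JID1_le_DQD hJ, fun v => ?_⟩, hH⟩
  have h : ∀ b : Bool, (!b && !!b) = false := by decide
  exact ULift.ext _ _ (h (v 0).down)

/-- A bound for the variables of a term: all of them are `var m` with `m < t.bound`. -/
def Term.bound : Term → ℕ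
  | .var n => n + 1
  | .sup s t => max s.bound t.bound
  | .inf s t => max s.bound t.bound
  | .imp s t => max s.bound t.bound
  | .neg s => s.bound
  | .bot => 0
  | .top => 0

theorem Term.eval_congr {A : Alg.{u}} {v w : ℕ → A.carrier} {n : ℕ} (h : ∀ m < n, v m = w m)
    (t : Term) (ht : t.bound ≤ n) : t.eval A v = t.eval A w := by
  induction t with
  | var k => exact h k ht
  | sup s t hs ht' =>
    rw [bound, max_le_iff] at ht
    rw [eval, eval, hs ht.1, ht' ht.2]
  | inf s t hs ht' =>
    rw [bound, max_le_iff] at ht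
    rw [eval, eval, hs ht.1, ht' ht.2]
  | imp s t hs ht' =>
    rw [bound, max_le_iff] at ht
    rw [eval, eval, hs ht.1, ht' ht.2]
  | neg s hs =>
    rw [bound] at ht
    rw [eval, eval, hs ht]
  | bot => rfl
  | top => rfl

/-- The term `x′ ∧ x′′`, which vanishes in dually Stone algebras. -/
def stoneTerm (s : Term) : Term := ￢s ⊓ ￢￢s

/-- The join over `m < n` of `p ∨ p′*`, where `p = xₘ′ ∧ xₘ′′`. It vanishes in dually Stone
algebras, and in `D₂` it is `1` unless `x₀, …, xₙ₋₁` take their values in `{0, 1}`. -/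
def stoneDefect : ℕ → Term
  | 0 => ⊥
  | n + 1 => stoneDefect n ⊔ (stoneTerm (.var n) ⊔ pstar (￢(stoneTerm (.var n))))

theorem stoneDefect_eval_of_dSt {α : Type u} [DQDAlgebra α] (h : ∀ a : α, ￢a ⊓ ￢￢a = ⊥)
    (v : ℕ → α) (n : ℕ) : (stoneDefect n).eval (toAlg α) v = (⊥ : α) := by
  induction n with
  | zero => rfl
  | succ n ih =>
    change (stoneDefect n).eval (toAlg α) v ⊔
      ((￢v n ⊓ ￢￢v n) ⊔ (￢(￢v n ⊓ ￢￢v n))ᶜ) = ⊥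
    rw [ih, h, neg_bot, compl_top, sup_idem, sup_idem]

theorem stoneDefect_eval_D2 (v : ℕ → D2.{u}.carrier) (n : ℕ)
    (h : ∃ m < n, (v m).down = .a ∨ (v m).down = .b) :
    (stoneDefect n).eval D2 v = D2.top := by
  have htop : ∀ p, Four.sup p .i = .i := by rintro (_ | _) <;> rfl
  induction n with
  | zero => simp at h
  | succ n ih =>
    obtain ⟨m, hm, hv⟩ := h
    rcases Nat.lt_succ_iff_lt_or_eq.1 hm with hlt | rfl
    · change D2.sup ((stoneDefect n).eval D2 v) _ = D2.top
      rw [ih ⟨m, hlt, hv⟩]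
      rfl
    · refine ULift.ext _ _ ?_
      let p : Four → Four := fun c => Four.inf (Four.neg c) (Four.neg (Four.neg c))
      change Four.sup ((stoneDefect m).eval D2 v).down
        (Four.sup (p (v m).down) (Four.imp2 (Four.neg (p (v m).down)) .o)) = .i
      rcases hv with hv | hv <;> rw [hv] <;> exact htop _

/-- Joining with `V(D₂)` adds no dually Stone algebras to a nontrivial variety: if `s ≈ t` holds
in `V`, then `s ∨ d ≈ t ∨ d`, with `d` the term `stoneDefect` in the variables of `s` and `t`,
holds both in `V` and in `D₂`, and on dually Stone algebras it is equivalent to `s ≈ t`. -/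
theorem sup_generated_inf_DStH {V : Variety.{u}} (hV : V ≤ DStH) (hne : V ≠ ⊥) :
    (V ⊔ generated {D2}) ⊓ DStH ≤ V := fun A hA => by
  obtain ⟨hA, hS⟩ := mem_inf_iff.1 hA
  refine V.mem_of_satisfies fun e he => ?_
  have two_sat := he two (two_mem_of_ne_bot hV hne)
  set n := max e.lhs.bound e.rhs.bound with hn
  have hd : ∀ {B : Alg.{u}}, B ∈ DStH.algebras →
      (B.Satisfies (e.lhs ⊔ stoneDefect n ≐ e.rhs ⊔ stoneDefect n) ↔ B.Satisfies e) := by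
    intro B hB
    have hB' := (mem_definedBy_iff.1 hB).1
    refine DQD_induction (p := fun B => B ∈ DSt.algebras →
      (B.Satisfies (e.lhs ⊔ stoneDefect n ≐ e.rhs ⊔ stoneDefect n) ↔ B.Satisfies e))
      (fun α _ h => ?_) (DSt_le_DQD hB') hB'
    refine forall_congr' fun v => ?_
    change e.lhs.eval (toAlg α) v ⊔ (stoneDefect n).eval (toAlg α) v =
      e.rhs.eval (toAlg α) v ⊔ (stoneDefect n).eval (toAlg α) v ↔ _
    rw [stoneDefect_eval_of_dSt (toAlg_mem_DSt_iff.1 h), sup_bot_eq, sup_bot_eq]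
  refine (hd hS).1 (mem_sup_iff.1 hA _ (fun B hB => (hd (hV hB)).2 (he B hB)) fun B hB => ?_)
  refine mem_generated_iff.1 hB _ ?_
  rintro _ rfl v
  change D2.sup (e.lhs.eval D2 v) ((stoneDefect n).eval D2 v) =
    D2.sup (e.rhs.eval D2 v) ((stoneDefect n).eval D2 v)
  by_cases hv : ∃ m < n, (v m).down = .a ∨ (v m).down = .b
  · rw [stoneDefect_eval_D2 v n hv]
    have htop : ∀ p, Four.sup p .i = .i := by rintro (_ | _) <;> rfl
    exact ULift.ext _ _ ((htop _).trans (htop _).symm)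
  · push Not at hv
    let w : ℕ → two.{u}.carrier := fun m => ⟨decide ((v m).down = .i)⟩
    have hw : ∀ m < n, v m = (ofTwo D2 ∘ w) m := by
      intro m hm
      refine ULift.ext _ _ ?_
      have h1 := hv m hm
      have h2 : ∀ c : Four, c ≠ .a ∧ c ≠ .b →
          c = (bif decide (c = .i) then D2.{u}.top else D2.{u}.bot).down := by
        rintro (_ | _) ⟨h1, h2⟩ <;> first | rfl | contradiction
      exact h2 _ h1
    rw [Term.eval_congr hw e.lhs (le_max_left _ _), Term.eval_congr hw e.rhs (le_max_right _ _),
      ← isHom_ofTwo_D2.eval, ← isHom_ofTwo_D2.eval, two_sat]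

/-- `V(D₂)` if `j = 1`, and the trivial variety if `j = 0`. -/
def booleanSummand (j : Fin 2) : Variety.{u} := if j = 0 then ⊥ else generated {D2}

theorem sup_booleanSummand_le_JIDH1 (V : NontrivialSubvarieties DStH.{u}) (j : Fin 2) :
    V.1 ⊔ booleanSummand j ≤ JIDH1 := by
  refine sup_le (V.2.2.trans DStH_le_JIDH1) ?_
  rw [booleanSummand]
  split_ifs
  · exact bot_le
  · exact generated_le_iff.2 (Set.singleton_subset_iff.2 D2_mem_JIDH1)

theorem sup_booleanSummand_le_iff (V W : NontrivialSubvarieties DStH.{u}) (j k : Fin 2) :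
    V.1 ⊔ booleanSummand j ≤ W.1 ⊔ booleanSummand k ↔ V ≤ W ∧ j ≤ k := by
  have hmono : booleanSummand.{u} k ≤ generated {D2} := by
    rw [booleanSummand]
    split_ifs
    exacts [bot_le, le_rfl]
  constructor
  · intro h
    refine ⟨?_, ?_⟩
    · exact (le_inf (le_sup_left.trans (h.trans (sup_le_sup_left hmono _))) V.2.2).trans
        (sup_generated_inf_DStH W.2.2 W.2.1.ne')
    · by_contra hjk
      obtain ⟨rfl, rfl⟩ : j = 1 ∧ k = 0 := by omega
      have h1 : generated {D2} ≤ W.1 := by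
        refine (le_sup_right.trans h).trans ?_
        simp [booleanSummand]
      exact D2_notMem_DSt (mem_definedBy_iff.1 (W.2.2 (generated_le_iff.1 h1 rfl))).1
  · rintro ⟨h1, h2⟩
    refine sup_le_sup h1 ?_
    by_cases hj : j = 0
    · rw [booleanSummand, if_pos hj]
      exact bot_le
    · have hk : k ≠ 0 := by omega
      rw [booleanSummand, booleanSummand, if_neg hj, if_neg hk]

/-- The subvariety of `JIDH₁` given by an element of `1 ⊕ (L⁺(DStH) × 2)`. -/
def ofSum (c : Unit ⊕ₗ (NontrivialSubvarieties DStH.{u} × Fin 2)) : Subvarieties JIDH1.{u} :=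
  match ofLex c with
  | .inl _ => ⟨⊥, Set.mem_Iic.2 bot_le⟩
  | .inr p => ⟨p.1.1 ⊔ booleanSummand p.2, sup_booleanSummand_le_JIDH1 p.1 p.2⟩

theorem ofSum_le_iff (c d : Unit ⊕ₗ (NontrivialSubvarieties DStH.{u} × Fin 2)) :
    ofSum c ≤ ofSum d ↔ c ≤ d := by
  obtain ⟨c, rfl⟩ := toLex.surjective c
  obtain ⟨d, rfl⟩ := toLex.surjective d
  rcases c with c | ⟨V, j⟩ <;> rcases d with d | ⟨W, k⟩
  · exact iff_of_true le_rfl (Sum.Lex.inl_le_inl_iff.2 le_rfl)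
  · exact iff_of_true (bot_le (a := W.1 ⊔ booleanSummand k)) (Sum.Lex.inl_le_inr _ _)
  · refine iff_of_false (fun h => ?_) Sum.Lex.not_inr_le_inl
    exact V.2.1.not_ge (le_sup_left.trans h)
  · rw [Sum.Lex.inr_le_inr_iff]
    exact sup_booleanSummand_le_iff V W j k

theorem ofSum_surjective : Function.Surjective ofSum.{u} := by
  rintro ⟨W, hW⟩
  by_cases hD : D2 ∈ W.algebras
  · refine ⟨toLex (.inr (⟨W ⊓ DStH, bot_lt_iff_ne_bot.2 fun h => ?_, inf_le_right⟩, 1)),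
      Subtype.ext (eq_sup_of_D2_mem hW hD).symm⟩
    have h2 : two ∈ W.algebras := W.mem_of_forall_satisfies hD fun e =>
      isHom_ofTwo_D2.satisfies_of_injective ofTwo_D2_injective
    exact two_notMem_bot (h ▸ mem_inf_iff.2 ⟨h2, two_mem_DStH⟩)
  · by_cases h : W = ⊥
    · exact ⟨toLex (.inl ()), Subtype.ext h.symm⟩
    · exact ⟨toLex (.inr (⟨W, bot_lt_iff_ne_bot.2 h, le_DStH_of_D2_notMem hW hD⟩, 0)),
        Subtype.ext (sup_bot_eq W)⟩

end JIDist

theorem corollary5p10 :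
    -- `JID₁ = DSt ∨ V(D₁, D₂, D₃)`
    JIDist.JID1.{u} =
        JIDist.DSt.{u} ⊔ JIDist.generated.{u} {JIDist.D1.{u}, JIDist.D2.{u}, JIDist.D3.{u}} ∧
    -- `V(D₁, D₂, D₃)` is the variety of De Morgan Boolean semi-Heyting algebras
    JIDist.generated.{u} {JIDist.D1.{u}, JIDist.D2.{u}, JIDist.D3.{u}} = JIDist.DMB.{u} ∧
    -- `JIDH₁ = DStH ∨ V(D₂)`
    JIDist.JIDH1.{u} = JIDist.DStH.{u} ⊔ JIDist.generated.{u} {JIDist.D2.{u}} ∧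
    -- the lattice of subvarieties of `JIDH₁` is `1 ⊕ (L⁺(DStH) × 2)`
    Nonempty (JIDist.Subvarieties JIDist.JIDH1.{u} ≃o
      (Unit ⊕ₗ (JIDist.NontrivialSubvarieties JIDist.DStH.{u} × Fin 2))) :=
  ⟨JIDist.JID1_eq_sup, JIDist.generated_D1_D2_D3, JIDist.JIDH1_eq_sup,
    ⟨(RelIso.ofSurjective (OrderEmbedding.ofMapLEIff _ JIDist.ofSum_le_iff)
      JIDist.ofSum_surjective).symm⟩⟩
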